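/- Let $L\ge 1$, $\mathcal L=\{0,\dots,L\}$, let $\mathcal X$ be a measurable space, let $\mathcal G$ be a class of measurable classifiers $g:\mathcal X\to\mathcal L$, and let $\mathbf P=(P_0,\dots,P_L)$ be probability measures on $\mathcal X$. Write $p_{\vartheta,m}(g)=P_\vartheta(g(X)=m)$, and call $g\in\mathcal G$ a \emph{separable classifier} for $\mathbf P$ if $p_{\vartheta,\vartheta}(g)>\max_{m\ne\vartheta}p_{\vartheta,m}(g)$ for every $\vartheta\in\mathcal L$. Let $\mathcal P_{\mathrm{sep}}$ be the set of all $\mathbf P$ that have a separable classifier in $\mathcal G$. For $m\in\mathcal L$ let $F_m=\{x\mapsto \mathbf 1\{g(x)=m\}: g\in\mathcal G\}$. Assume $\mathrm{VCdim}(F_m)\le d$ for every $m\in\mathcal L$, where $d\ge 0$ is an integer ($0^0=1$). Assume moreover the usual measurability of the class on finite samples: for all $\vartheta,m\in\mathcal L$, $n\in\mathbb N$ and $S\subseteq\{1,\dots,n\}$, the set $\{x\in\mathcal X^n:\ \exists g\in\mathcal G\ \forall i,\ g(x_i)=m\iff i\in S\}$ is measurable up to $P_\vartheta^{\otimes n}$-null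 sets. Let $\mathbf P\in\mathcal P_{\mathrm{sep}}$. Then there is $g^*\in\mathcal G$ with $$\Delta^*:=\min_{\vartheta\in\mathcal L}\min_{m\ne\vartheta}\bigl(p_{\vartheta,\vartheta}(g^*)-p_{\vartheta,m}(g^*)\bigr)>0 .$$ For every such $g^*$, put $\gamma=\Delta^*/8$, let $\delta\in(0,1)$, and let $N\in\mathbb N$ satisfy $$N\ \ge\ \max\Bigl\{d,\ \frac{8}{\gamma^2}\log\frac{(L+1)^2\cdot 4\,(2eN)^d/d^d}{\delta}\Bigr\}.$$ For each $\vartheta\in\mathcal L$ let $T_{\vartheta,1},\dots,T_{\vartheta,N}$ be i.i.d. with law $P_\vartheta$, all defined on one probability space, and let $$\hat p_{\vartheta,m}(g)=\frac1N\sum_{i=1}^N\mathbf 1\{g(T_{\vartheta,i})=m\},\qquad \hat\Delta(g)=\min_{\vartheta\in\mathcal L}\min_{m\ne\vartheta}\bigl(\hat p_{\vartheta,\vartheta}(g)-\hat p_{\vartheta,m}(g)\bigr).$$ Then $\hat\Delta$ attains its maximum over $\mathcal G$, and with probability at least $1-\delta$ every maximizer $\hat g\in\arg\max_{g\in\mathcal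 G}\hat\Delta(g)$ is a separable classifier for $\mathbf P$, i.e. $p_{\vartheta,\vartheta}(\hat g)>\max_{m\ne\vartheta}p_{\vartheta,m}(\hat g)$ for all $\vartheta\in\mathcal L$. (Precisely: there is an event of probability at least $1-\delta$ on which this holds.) -/

import Mathlib

open MeasureTheory ProbabilityTheory

noncomputable section

namespace EmpSep

/-- A family `F` of subsets of `X` (equivalently, of `{0,1}`-valued functions on `X`) shatters the
finite set `s` if every subset of `s` is cut out of `s` by a member of `F`. -/
def Shatters {X : Type*} (F : Set (Set X)) (s : Finset X) : Prop :=
  ∀ t : Set X, t ⊆ s → ∃ A ∈ F, (s : Set X) ∩ A = t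

/-- The VC dimension: the supremum of the cardinalities of the finite sets that are shattered. -/
def vcDim {X : Type*} (F : Set (Set X)) : ℕ∞ :=
  ⨆ (s : Finset X) (_ : Shatters F s), (s.card : ℕ∞)

/-- The measurability convention for a family `F` of sets and a law `ν`: whether some member of `F`
selects exactly the points with index in `S` out of a sample of `n` points is an event
(measurable up to null sets) for the law `ν ^ n` of an i.i.d. sample. -/
def SampleMeasurable {X : Type*} [MeasurableSpace X] (F : Set (Set X)) (ν : Measure X) : Prop :=
  ∀ (n : ℕ) (S : Set (Fin n)),
    NullMeasurableSet {x : Fin n → X | ∃ A ∈ F, ∀ i, x i ∈ A ↔ i ∈ S} (Measure.pi fun _ => ν)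

variable {X : Type*} {L : ℕ}

/-- The class `F_m` of the indicators of `g(x) = m`, for `g ∈ G`; an indicator is represented by the
set on which it equals one. -/
def labelClass (G : Set (X → Fin (L + 1))) (m : Fin (L + 1)) : Set (Set X) :=
  {A | ∃ g ∈ G, A = {x | g x = m}}

/-- The gap `min_ϑ min_{m ≠ ϑ} (q ϑ ϑ - q ϑ m)` of a matrix `q`. (It is only used for `1 ≤ L`, where
these are infima over nonempty finite sets.) -/
def gap (q : Fin (L + 1) → Fin (L + 1) → ℝ) : ℝ :=
  ⨅ ϑ : Fin (L + 1), ⨅ m : {m : Fin (L + 1) // m ≠ ϑ}, (q ϑ ϑ - q ϑ m)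

/-- The empirical confusion probability, the fraction of the `N` samples `t ϑ 0, …, t ϑ (N - 1)` with
label `ϑ` that `g` classifies as `m`. -/
def empConf {N : ℕ} (t : Fin (L + 1) → Fin N → X) (g : X → Fin (L + 1))
    (ϑ m : Fin (L + 1)) : ℝ :=
  (1 / (N : ℝ)) * ∑ i : Fin N, if g (t ϑ i) = m then (1 : ℝ) else 0

/-- The set of maximizers over `G` of the empirical gap for the training data `t`. -/
def empGapArgmax {N : ℕ} (G : Set (X → Fin (L + 1))) (t : Fin (L + 1) → Fin N → X) :
    Set (X → Fin (L + 1)) :=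
  {g | g ∈ G ∧ ∀ h ∈ G, gap (empConf t h) ≤ gap (empConf t g)}

variable [MeasurableSpace X]

/-- The confusion probability `P_ϑ(g(X) = m)`. -/
def conf (P : Fin (L + 1) → ProbabilityMeasure X) (g : X → Fin (L + 1))
    (ϑ m : Fin (L + 1)) : ℝ :=
  (P ϑ : Measure X).real {x | g x = m}

/-- `g` is a separable classifier for the tuple `P`. -/
def IsSeparableClassifier (P : Fin (L + 1) → ProbabilityMeasure X) (g : X → Fin (L + 1)) : Prop :=
  ∀ ϑ m : Fin (L + 1), m ≠ ϑ → conf P g ϑ m < conf P g ϑ ϑ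

/-- The tuples of distributions that are distinguishable by the hypothesis class `G`. -/
def Psep (G : Set (X → Fin (L + 1))) : Set (Fin (L + 1) → ProbabilityMeasure X) :=
  {P | ∃ g ∈ G, IsSeparableClassifier P g}

end EmpSep

end

/-! If every empirical confusion probability is within 2γ of the true one, uniformly over the class,
each difference entering a gap moves by less than 4γ. A maximizer has empirical gap at least that of
`gstar`, which exceeds 8γ - 4γ, so its true gap is positive
(`isSeparableClassifier_of_mem_empGapArgmax`).

The uniform closeness is the Vapnik–Chervonenkis argument (`measure_uniform_deviation_le`). A ghost
sample replaces the true probability, by Chebyshev, at the cost of a factor 2. The law of the double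
sample is invariant under swapping the i-th points of its halves, so one may average over all swaps
with the points held fixed. The class then acts only through its finitely many patterns on 2n
points, counted by Sauer–Shelah, and Hoeffding bounds the bad swaps for each pattern
(`card_swaps_le`). A union bound over the (L+1)² label pairs finishes. -/

namespace EmpSep

/-! ### Hoeffding's inequality by counting signs -/

/-- Hoeffding's inequality for Rademacher signs, as a count of sign vectors. -/
theorem card_signs_sum_ge_le {ι : Type*} [Fintype ι] [DecidableEq ι] (c : ι → ℝ)
    (hc : ∀ i, |c i| ≤ 1) {γ : ℝ} (hγ : 0 ≤ γ) :
    ((Finset.univ.filter fun σ : ι → Bool =>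
      Fintype.card ι * γ ≤ ∑ i, (if σ i then -1 else 1) * c i).card : ℝ) ≤
      2 ^ Fintype.card ι * Real.exp (-(Fintype.card ι * γ ^ 2 / 2)) := by
  set n := Fintype.card ι
  set B := Finset.univ.filter fun σ : ι → Bool => n * γ ≤ ∑ i, (if σ i then -1 else 1) * c i
  have hsum : ∑ σ : ι → Bool, Real.exp (γ * ∑ i, (if σ i then -1 else 1) * c i) ≤
      2 ^ n * Real.exp (n * γ ^ 2 / 2) := by
    have h1 : ∑ σ : ι → Bool, Real.exp (γ * ∑ i, (if σ i then -1 else 1) * c i) =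
        ∏ i, ∑ b : Bool, Real.exp (γ * ((if b then -1 else 1) * c i)) := by
      rw [Finset.prod_univ_sum, Fintype.piFinset_univ]
      refine Finset.sum_congr rfl fun σ _ => ?_
      rw [Finset.mul_sum, Real.exp_sum]
    have h2 : ∀ i, ∑ b : Bool, Real.exp (γ * ((if b then -1 else 1) * c i)) ≤
        2 * Real.exp (γ ^ 2 / 2) := by
      intro i
      have h3 : ∑ b : Bool, Real.exp (γ * ((if b then -1 else 1) * c i)) =
          2 * Real.cosh (γ * c i) := by
        rw [Real.cosh_eq]
        simp
        ring
      rw [h3]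
      refine mul_le_mul_of_nonneg_left ((Real.cosh_le_exp_half_sq _).trans ?_) (by norm_num)
      have h4 : (c i) ^ 2 ≤ 1 := (sq_le_one_iff_abs_le_one _).2 (hc i)
      refine Real.exp_le_exp.2 ?_
      rw [mul_pow]
      nlinarith [sq_nonneg γ]
    rw [h1]
    refine (Finset.prod_le_prod (fun i _ => by positivity) fun i _ => h2 i).trans_eq ?_
    rw [Finset.prod_const, mul_pow, ← Real.exp_nat_mul, Finset.card_univ, mul_div_assoc]
  -- Exponential Markov inequality; the parameter γ minimizes nλ²/2 - λnγ over λ.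
  have hB : (B.card : ℝ) * Real.exp (n * γ ^ 2) ≤ 2 ^ n * Real.exp (n * γ ^ 2 / 2) := by
    refine le_trans ?_ hsum
    rw [← nsmul_eq_mul, ← Finset.sum_const]
    refine (Finset.sum_le_sum fun σ hσ => ?_).trans
      (Finset.sum_le_univ_sum_of_nonneg fun σ => (Real.exp_pos _).le)
    refine Real.exp_le_exp.2 ?_
    have := (Finset.mem_filter.1 hσ).2
    nlinarith
  rw [← le_div_iff₀ (Real.exp_pos _), mul_div_assoc, ← Real.exp_sub] at hB
  rwa [show (n * γ ^ 2 / 2 - n * γ ^ 2 : ℝ) = -(n * γ ^ 2 / 2) by ring] at hB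

theorem card_signs_abs_sum_ge_le {ι : Type*} [Fintype ι] [DecidableEq ι] (c : ι → ℝ)
    (hc : ∀ i, |c i| ≤ 1) {γ : ℝ} (hγ : 0 ≤ γ) :
    ((Finset.univ.filter fun σ : ι → Bool =>
      Fintype.card ι * γ ≤ |∑ i, (if σ i then -1 else 1) * c i|).card : ℝ) ≤
      2 ^ Fintype.card ι * (2 * Real.exp (-(Fintype.card ι * γ ^ 2 / 2))) := by
  have h1 := card_signs_sum_ge_le c hc hγ
  have h2 := card_signs_sum_ge_le (fun i => -c i) (fun i => by simpa using hc i) hγ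
  have h3 : (Finset.univ.filter fun σ : ι → Bool =>
      Fintype.card ι * γ ≤ |∑ i, (if σ i then -1 else 1) * c i|) ⊆
      (Finset.univ.filter fun σ : ι → Bool =>
        Fintype.card ι * γ ≤ ∑ i, (if σ i then -1 else 1) * c i) ∪
      (Finset.univ.filter fun σ : ι → Bool =>
        Fintype.card ι * γ ≤ ∑ i, (if σ i then -1 else 1) * -c i) := by
    intro σ hσ
    simp only [Finset.mem_union, Finset.mem_filter, Finset.mem_univ, true_and, mul_neg,
      Finset.sum_neg_distrib] at hσ ⊢
    exact le_abs.1 hσ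
  have h4 : ((Finset.univ.filter fun σ : ι → Bool =>
      Fintype.card ι * γ ≤ |∑ i, (if σ i then -1 else 1) * c i|).card : ℝ) ≤ _ :=
    Nat.cast_le.2 ((Finset.card_le_card h3).trans (Finset.card_union_le _ _))
  push_cast at h4
  linarith

/-! ### Growth function of a VC class -/

theorem sum_choose_le {n d : ℕ} (hdn : d ≤ n) :
    (∑ k ∈ Finset.Iic d, n.choose k : ℝ) ≤ (Real.exp 1 * n) ^ d / (d : ℝ) ^ d := by
  rcases Nat.eq_zero_or_pos d with rfl | hd
  · simp [show Finset.Iic 0 = {0} from rfl]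
  have hn : (0 : ℝ) < n := by exact_mod_cast hd.trans_le hdn
  have hd' : (0 : ℝ) < d := by exact_mod_cast hd
  set r : ℝ := d / n
  have hr : 0 < r := div_pos hd' hn
  have hr1 : r ≤ 1 := (div_le_one hn).2 (by exact_mod_cast hdn)
  -- Since r = d/n ≤ 1, r ^ d is at most r ^ k for k ≤ d; the binomial theorem and 1 + r ≤ exp r
  -- then give exp d.
  have h1 : (∑ k ∈ Finset.Iic d, n.choose k : ℝ) * r ^ d ≤ Real.exp d := by
    calc (∑ k ∈ Finset.Iic d, n.choose k : ℝ) * r ^ d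
        ≤ ∑ k ∈ Finset.Iic d, r ^ k * n.choose k := by
          rw [Finset.sum_mul]
          refine Finset.sum_le_sum fun k hk => ?_
          rw [mul_comm]
          exact mul_le_mul_of_nonneg_right
            (pow_le_pow_of_le_one hr.le hr1 (Finset.mem_Iic.1 hk)) (Nat.cast_nonneg _)
      _ ≤ ∑ k ∈ Finset.range (n + 1), r ^ k * n.choose k := by
          refine Finset.sum_le_sum_of_subset_of_nonneg (fun k hk => ?_)
            fun k _ _ => by positivity
          have := Finset.mem_Iic.1 hk
          exact Finset.mem_range.2 (by omega)
      _ = (r + 1) ^ n := by simp [add_pow]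
      _ ≤ (Real.exp r) ^ n := by
          gcongr
          exact Real.add_one_le_exp r
      _ = Real.exp d := by
          rw [← Real.exp_nat_mul]
          congr 1
          exact mul_div_cancel₀ _ hn.ne'
  rw [← le_div_iff₀ (by positivity)] at h1
  refine h1.trans_eq ?_
  rw [div_pow, mul_pow, ← Real.exp_nat_mul, mul_one]
  field_simp

open Classical in
/-- The index sets picked out by members of `F` from the points `z i`. -/
noncomputable def patterns {X ι : Type*} [Fintype ι] (F : Set (Set X)) (z : ι → X) :
    Finset (Finset ι) :=
  Finset.univ.filter fun S => ∃ A ∈ F, ∀ i, z i ∈ A ↔ i ∈ S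

theorem mem_patterns {X ι : Type*} [Fintype ι] {F : Set (Set X)} {z : ι → X} {S : Finset ι} :
    S ∈ patterns F z ↔ ∃ A ∈ F, ∀ i, z i ∈ A ↔ i ∈ S := by
  simp [patterns]

/-- Sample points may coincide, but no pattern separates two indices of equal points. Hence `z` is
injective on a shattered index set, whose image is shattered by `F` with the same cardinality. -/
theorem card_le_of_shatters_patterns {X ι : Type*} [Fintype ι] [DecidableEq ι] {F : Set (Set X)}
    {d : ℕ} (hF : vcDim F ≤ d) {z : ι → X} {s : Finset ι} (hs : (patterns F z).Shatters s) :
    s.card ≤ d := by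
  classical
  have hinj : Set.InjOn z s := by
    intro i hi j hj hij
    by_contra hne
    obtain ⟨S, hS, hSi⟩ := hs (t := {i}) (by simpa using hi)
    obtain ⟨A, -, hA⟩ := mem_patterns.1 hS
    have hiS : i ∈ S := (Finset.mem_inter.1 (hSi ▸ Finset.mem_singleton_self i)).2
    have hjS : j ∈ S := (hA j).1 (hij ▸ (hA i).2 hiS)
    have : j ∈ ({i} : Finset ι) := hSi ▸ Finset.mem_inter.2 ⟨hj, hjS⟩
    exact hne (Finset.mem_singleton.1 this).symm
  have hsh : Shatters F (s.image z) := by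
    intro t ht
    obtain ⟨S, hS, hSt⟩ := hs (t := s.filter fun i => z i ∈ t) (Finset.filter_subset _ _)
    obtain ⟨A, hAF, hA⟩ := mem_patterns.1 hS
    refine ⟨A, hAF, ?_⟩
    have key : ∀ i ∈ s, (z i ∈ A ↔ z i ∈ t) := by
      intro i hi
      rw [hA i]
      have := Finset.ext_iff.1 hSt i
      simpa [hi] using this
    ext x
    constructor
    · rintro ⟨hx, hxA⟩
      obtain ⟨i, hi, rfl⟩ := Finset.mem_image.1 (Finset.mem_coe.1 hx)
      exact (key i hi).1 hxA
    · intro hx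
      have hx' := ht hx
      obtain ⟨i, hi, rfl⟩ := Finset.mem_image.1 (Finset.mem_coe.1 hx')
      exact ⟨hx', (key i hi).2 hx⟩
  have h1 : ((s.image z).card : ℕ∞) ≤ vcDim F :=
    le_iSup₂ (f := fun (s : Finset X) (_ : Shatters F s) => (s.card : ℕ∞)) _ hsh
  rw [Finset.card_image_of_injOn hinj] at h1
  exact_mod_cast h1.trans hF

/-- The Sauer–Shelah bound on the growth function of a class of VC dimension at most `d`. -/
theorem card_patterns_le {X ι : Type*} [Fintype ι] {F : Set (Set X)} {d : ℕ} (hF : vcDim F ≤ d)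
    (hd : d ≤ Fintype.card ι) (z : ι → X) :
    ((patterns F z).card : ℝ) ≤ (Real.exp 1 * Fintype.card ι) ^ d / (d : ℝ) ^ d := by
  classical
  refine le_trans ?_ (sum_choose_le hd)
  have h1 : (patterns F z).vcDim ≤ d :=
    Finset.sup_le fun s hs => card_le_of_shatters_patterns hF (Finset.mem_shatterer.1 hs)
  have h2 := (patterns F z).card_le_card_shatterer.trans
    ((patterns F z).card_shatterer_le_sum_vcDim.trans
      (Finset.sum_le_sum_of_subset (Finset.Iic_subset_Iic.2 h1)))
  exact_mod_cast h2

/-! ### Symmetrization of a double sample -/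

open scoped ENNReal

/-- Exchange the two halves of a double sample at the indices where `σ` is true. -/
def swapPerm {ι : Type*} (σ : ι → Bool) : Equiv.Perm (ι ⊕ ι) :=
  Function.Involutive.toPerm
    (Sum.elim (fun i => if σ i then Sum.inr i else Sum.inl i)
      (fun i => if σ i then Sum.inl i else Sum.inr i))
    (by rintro (i | i) <;> cases h : σ i <;> simp [h])

@[simp]
theorem swapPerm_inl {ι : Type*} (σ : ι → Bool) (i : ι) :
    swapPerm σ (Sum.inl i) = if σ i then Sum.inr i else Sum.inl i := rfl

@[simp]
theorem swapPerm_inr {ι : Type*} (σ : ι → Bool) (i : ι) :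
    swapPerm σ (Sum.inr i) = if σ i then Sum.inl i else Sum.inr i := rfl

theorem measurePreserving_comp_equiv {X ι : Type*} [Fintype ι] [MeasurableSpace X]
    (ν : Measure X) [IsProbabilityMeasure ν] {κ : Type*} [Fintype κ] (e : κ ≃ ι) :
    MeasurePreserving (fun z : ι → X => z ∘ e) (Measure.pi fun _ => ν)
      (Measure.pi fun _ => ν) :=
  measurePreserving_arrowCongr' (fun _ => ν) (fun _ => ν) e.symm (MeasurableEquiv.refl X)
    fun _ => MeasurePreserving.id ν

theorem nullMeasurableSet_patterns {X ι : Type*} [Fintype ι] [MeasurableSpace X]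
    {F : Set (Set X)} {ν : Measure X} [IsProbabilityMeasure ν] (hF : SampleMeasurable F ν)
    (S : Finset ι) :
    NullMeasurableSet {z : ι → X | S ∈ patterns F z} (Measure.pi fun _ => ν) := by
  let e := Fintype.equivFin ι
  have h := (hF (Fintype.card ι) {k | e.symm k ∈ S}).preimage
    (measurePreserving_comp_equiv ν e.symm).quasiMeasurePreserving
  convert h using 1
  ext z
  simp only [mem_patterns, Set.mem_ofPred_eq, Set.mem_preimage, Function.comp_apply]
  refine exists_congr fun A => and_congr_right fun _ => ?_
  exact ⟨fun h k => h _, fun h i => by simpa using h (e i)⟩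

/-- The double samples on whose halves the frequencies of some member of `F` differ by at least
`γ`. -/
def ghostDeviation {X : Type*} (ι : Type*) [Fintype ι] (F : Set (Set X)) (γ : ℝ) :
    Set (ι ⊕ ι → X) :=
  {z | ∃ A ∈ F, Fintype.card ι * γ ≤
    |∑ i, (A.indicator (1 : X → ℝ) (z (Sum.inl i)) - A.indicator (1 : X → ℝ) (z (Sum.inr i)))|}

/-- A swap at `i` flips the sign of the i-th difference, and a member of `F` enters only through its
pattern on `z`. This turns a quantifier over `F` into one over a finite set. -/
theorem comp_swapPerm_mem_ghostDeviation {X ι : Type*} [Fintype ι] [DecidableEq ι]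
    {F : Set (Set X)} {γ : ℝ} {z : ι ⊕ ι → X} (σ : ι → Bool) :
    z ∘ swapPerm σ ∈ ghostDeviation ι F γ ↔ ∃ S ∈ patterns F z, Fintype.card ι * γ ≤
      |∑ i, (if σ i then -1 else 1) *
        ((if Sum.inl i ∈ S then (1 : ℝ) else 0) - if Sum.inr i ∈ S then 1 else 0)| := by
  classical
  have key : ∀ (A : Set X) (S : Finset (ι ⊕ ι)), (∀ k, z k ∈ A ↔ k ∈ S) → ∀ i,
      A.indicator (1 : X → ℝ) ((z ∘ swapPerm σ) (Sum.inl i)) -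
        A.indicator (1 : X → ℝ) ((z ∘ swapPerm σ) (Sum.inr i)) =
      (if σ i then -1 else 1) *
        ((if Sum.inl i ∈ S then (1 : ℝ) else 0) - if Sum.inr i ∈ S then 1 else 0) := by
    intro A S h i
    cases hσ : σ i <;>
      simp [hσ, Set.indicator_apply, h]
  constructor
  · rintro ⟨A, hA, h⟩
    have hS : ∀ k, z k ∈ A ↔ k ∈ Finset.univ.filter fun k => z k ∈ A := by simp
    refine ⟨_, mem_patterns.2 ⟨A, hA, hS⟩, ?_⟩
    rwa [Finset.sum_congr rfl fun i _ => key A _ hS i] at h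
  · rintro ⟨S, hS, h⟩
    obtain ⟨A, hA, hAS⟩ := mem_patterns.1 hS
    refine ⟨A, hA, ?_⟩
    rwa [Finset.sum_congr rfl fun i _ => key A S hAS i]

theorem nullMeasurableSet_ghostDeviation {X ι : Type*} [Fintype ι] [MeasurableSpace X]
    {F : Set (Set X)} {ν : Measure X} [IsProbabilityMeasure ν] (hF : SampleMeasurable F ν)
    (γ : ℝ) : NullMeasurableSet (ghostDeviation ι F γ) (Measure.pi fun _ => ν) := by
  classical
  -- The trivial swap exhibits the event as a finite union of pattern events, which are null
  -- measurable by hypothesis.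
  have h : ghostDeviation ι F γ = ⋃ S : Finset (ι ⊕ ι), {z | S ∈ patterns F z} ∩
      {_z | Fintype.card ι * γ ≤ |∑ i, (if (fun _ => false : ι → Bool) i then -1 else 1) *
        ((if Sum.inl i ∈ S then (1 : ℝ) else 0) - if Sum.inr i ∈ S then 1 else 0)|} := by
    ext z
    have h1 : z ∘ swapPerm (fun _ : ι => false) = z := by
      funext k
      rcases k with i | i <;> simp
    rw [← h1, comp_swapPerm_mem_ghostDeviation, h1]
    simp only [Set.mem_iUnion, Set.mem_inter_iff, Set.mem_ofPred_eq]
  rw [h]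
  exact NullMeasurableSet.iUnion fun S =>
    (nullMeasurableSet_patterns hF S).inter (MeasurableSet.const _).nullMeasurableSet

theorem card_swaps_le {X ι : Type*} [Fintype ι] [DecidableEq ι] {F : Set (Set X)} {d : ℕ}
    (hF : vcDim F ≤ d) (hd : d ≤ Fintype.card ι) {γ : ℝ} (hγ : 0 ≤ γ) (z : ι ⊕ ι → X)
    [DecidablePred fun σ : ι → Bool => z ∘ swapPerm σ ∈ ghostDeviation ι F γ] :
    ((Finset.univ.filter fun σ : ι → Bool =>
      z ∘ swapPerm σ ∈ ghostDeviation ι F γ).card : ℝ) ≤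
      2 ^ Fintype.card ι * ((2 * Real.exp 1 * Fintype.card ι) ^ d / (d : ℝ) ^ d *
        (2 * Real.exp (-(Fintype.card ι * γ ^ 2 / 2)))) := by
  have h1 : (Finset.univ.filter fun σ : ι → Bool => z ∘ swapPerm σ ∈ ghostDeviation ι F γ) ⊆
      (patterns F z).biUnion fun S => Finset.univ.filter fun σ : ι → Bool =>
        Fintype.card ι * γ ≤ |∑ i, (if σ i then -1 else 1) *
          ((if Sum.inl i ∈ S then (1 : ℝ) else 0) - if Sum.inr i ∈ S then 1 else 0)| := by
    intro σ hσ
    have := (comp_swapPerm_mem_ghostDeviation σ).1 (Finset.mem_filter.1 hσ).2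
    simpa using this
  have h2 := (Finset.card_le_card h1).trans Finset.card_biUnion_le
  have h3 : ((Finset.univ.filter fun σ : ι → Bool =>
      z ∘ swapPerm σ ∈ ghostDeviation ι F γ).card : ℝ) ≤ _ := Nat.cast_le.2 h2
  push_cast at h3
  refine h3.trans ((Finset.sum_le_card_nsmul _ _ _ fun S _ =>
    card_signs_abs_sum_ge_le _ (fun i => ?_) hγ).trans ?_)
  · split_ifs <;> simp
  · have h4 := card_patterns_le hF (by simp; omega) z
    rw [Fintype.card_sum, Nat.cast_add, ← two_mul, ← mul_assoc, mul_comm (Real.exp 1)] at h4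
    rw [nsmul_eq_mul, mul_left_comm]
    gcongr

theorem measure_ghostDeviation_le {X ι : Type*} [Fintype ι] [MeasurableSpace X]
    {F : Set (Set X)} {ν : Measure X} [IsProbabilityMeasure ν] (hm : SampleMeasurable F ν) {d : ℕ}
    (hF : vcDim F ≤ d) (hd : d ≤ Fintype.card ι) {γ : ℝ} (hγ : 0 ≤ γ) :
    (Measure.pi fun _ => ν) (ghostDeviation ι F γ) ≤ ENNReal.ofReal
      ((2 * Real.exp 1 * Fintype.card ι) ^ d / (d : ℝ) ^ d *
        (2 * Real.exp (-(Fintype.card ι * γ ^ 2 / 2)))) := by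
  classical
  set n := Fintype.card ι
  set D := ghostDeviation ι F γ
  set K := (2 * Real.exp 1 * n) ^ d / (d : ℝ) ^ d * (2 * Real.exp (-(n * γ ^ 2 / 2)))
  set μ : Measure (ι ⊕ ι → X) := Measure.pi fun _ => ν
  have hD : NullMeasurableSet D μ := nullMeasurableSet_ghostDeviation hm γ
  have hmp : ∀ σ : ι → Bool, MeasurePreserving (fun z : ι ⊕ ι → X => z ∘ swapPerm σ) μ μ :=
    fun σ => measurePreserving_comp_equiv ν (swapPerm σ)
  have hDσ : ∀ σ : ι → Bool, NullMeasurableSet ((fun z => z ∘ swapPerm σ) ⁻¹' D) μ :=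
    fun σ => hD.preimage (hmp σ).quasiMeasurePreserving
  -- Each of the 2 ^ n swaps preserves `μ`, so the left side is the expected number of swaps landing
  -- in `D`; that number is bounded pointwise in `z`.
  have h1 : (2 : ℝ≥0∞) ^ n * μ D =
      ∫⁻ z, ∑ σ : ι → Bool, ((fun z => z ∘ swapPerm σ) ⁻¹' D).indicator 1 z ∂μ := by
    have hind : ∀ σ : ι → Bool, AEMeasurable
        (((fun z => z ∘ swapPerm σ) ⁻¹' D).indicator (1 : (ι ⊕ ι → X) → ℝ≥0∞)) μ :=
      fun σ => (aemeasurable_const (b := (1 : ℝ≥0∞))).indicator₀ (hDσ σ)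
    rw [lintegral_finsetSum' _ fun σ _ => hind σ]
    simp_rw [lintegral_indicator_one₀ (hDσ _), (hmp _).measure_preimage hD]
    simp [n]
  have h2 : ∀ z : ι ⊕ ι → X,
      ∑ σ : ι → Bool, ((fun z => z ∘ swapPerm σ) ⁻¹' D).indicator (1 : (ι ⊕ ι → X) → ℝ≥0∞) z ≤
        (2 : ℝ≥0∞) ^ n * ENNReal.ofReal K := by
    intro z
    have h3 : ∑ σ : ι → Bool, ((fun z => z ∘ swapPerm σ) ⁻¹' D).indicator (1 : (ι ⊕ ι → X) → ℝ≥0∞) z =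
        ((Finset.univ.filter fun σ : ι → Bool => z ∘ swapPerm σ ∈ D).card : ℝ≥0∞) := by
      simp [Set.indicator_apply]
    have h4 : (2 : ℝ≥0∞) ^ n * ENNReal.ofReal K = ENNReal.ofReal (2 ^ n * K) := by
      rw [ENNReal.ofReal_mul (p := 2 ^ n) (by positivity), ENNReal.ofReal_pow (by norm_num)]
      simp
    rw [h3, h4, ← ENNReal.ofReal_natCast]
    exact ENNReal.ofReal_le_ofReal (card_swaps_le hF hd hγ z)
  have h5 : (2 : ℝ≥0∞) ^ n * μ D ≤ (2 : ℝ≥0∞) ^ n * ENNReal.ofReal K := by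
    rw [h1]
    exact (lintegral_mono h2).trans (by simp [μ])
  exact (ENNReal.mul_le_mul_iff_right (by simp) (by simp)).1 h5

/-! ### From the ghost sample to the true probability -/

/-- Chebyshev's inequality for the frequency of an event in an i.i.d. sample. -/
theorem measure_frequency_deviation_le {X ι : Type*} [Fintype ι] [MeasurableSpace X]
    (ν : Measure X) [IsProbabilityMeasure ν] {A : Set X} (hA : MeasurableSet A) {γ : ℝ}
    (hγ : 0 < γ) (hn : 1 ≤ Fintype.card ι * γ ^ 2) :
    (Measure.pi fun _ : ι => ν) {x | Fintype.card ι * γ ≤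
      |∑ i, A.indicator (1 : X → ℝ) (x i) - Fintype.card ι * ν.real A|} ≤ 2⁻¹ := by
  set n := Fintype.card ι
  have hn0 : (0 : ℝ) < n := by
    rcases (Nat.cast_nonneg n : (0 : ℝ) ≤ n).eq_or_lt with h | h
    · rw [← h] at hn; norm_num at hn
    · exact h
  have hmem : MemLp (A.indicator (1 : X → ℝ)) 2 ν := (memLp_const 1).indicator hA
  have hmem' : MemLp (∑ i, fun x : ι → X => A.indicator (1 : X → ℝ) (x i)) 2
      (Measure.pi fun _ => ν) :=
    memLp_finsetSum' _ fun i _ => hmem.comp_measurePreserving (measurePreserving_eval _ i)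
  have hE : ∫ x, (∑ i, fun x : ι → X => A.indicator (1 : X → ℝ) (x i)) x
      ∂(Measure.pi fun _ => ν) = n * ν.real A := by
    simp only [Finset.sum_apply]
    rw [integral_finsetSum]
    rotate_left
    · exact fun i _ => (hmem.comp_measurePreserving
        (measurePreserving_eval (fun _ : ι => ν) i)).integrable (by norm_num)
    have : ∀ i : ι, ∫ x : ι → X, A.indicator (1 : X → ℝ) (x i) ∂(Measure.pi fun _ => ν) =
        ν.real A := by
      intro i
      rw [integral_comp_eval (μ := fun _ : ι => ν) (f := A.indicator (1 : X → ℝ)) (i := i)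
        hmem.aestronglyMeasurable, integral_indicator_one hA]
    simp [this, n]
  have hV : Var[∑ i, fun x : ι → X => A.indicator (1 : X → ℝ) (x i); Measure.pi fun _ => ν] ≤
      n / 4 := by
    rw [variance_sum_pi fun _ => hmem]
    have hv : Var[A.indicator (1 : X → ℝ); ν] ≤ ((1 - 0) / 2) ^ 2 :=
      variance_le_sq_of_bounded (Filter.Eventually.of_forall fun x =>
        ⟨Set.indicator_nonneg (by simp) _, Set.indicator_le_self' (by simp) x⟩)
        hmem.aestronglyMeasurable.aemeasurable
    rw [Finset.sum_const, nsmul_eq_mul, Finset.card_univ]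
    nlinarith
  have h := meas_ge_le_variance_div_sq hmem' (c := n * γ) (by positivity)
  rw [hE] at h
  simp only [Finset.sum_apply] at h
  refine h.trans ?_
  rw [show (2⁻¹ : ℝ≥0∞) = ENNReal.ofReal 2⁻¹ by
    rw [ENNReal.ofReal_inv_of_pos (by norm_num)]; simp]
  refine ENNReal.ofReal_le_ofReal ?_
  rw [div_le_iff₀ (by positivity)]
  nlinarith

/-- The uniform law of large numbers for a class of finite VC dimension, for outer measure. -/
theorem measure_uniform_deviation_le {X ι : Type*} [Fintype ι] [MeasurableSpace X]
    {F : Set (Set X)} {ν : Measure X} [IsProbabilityMeasure ν] (hm : SampleMeasurable F ν)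
    (hFm : ∀ A ∈ F, MeasurableSet A) {d : ℕ}
    (hF : vcDim F ≤ d) (hd : d ≤ Fintype.card ι) {γ : ℝ} (hγ : 0 < γ)
    (hn : 1 ≤ Fintype.card ι * γ ^ 2) :
    (Measure.pi fun _ => ν) {x : ι → X | ∃ A ∈ F, Fintype.card ι * (2 * γ) ≤
      |∑ i, A.indicator (1 : X → ℝ) (x i) - Fintype.card ι * ν.real A|} ≤ ENNReal.ofReal
      (4 * ((2 * Real.exp 1 * Fintype.card ι) ^ d / (d : ℝ) ^ d) *
        Real.exp (-(Fintype.card ι * γ ^ 2 / 2))) := by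
  set n := Fintype.card ι
  set μ : Measure (ι → X) := Measure.pi fun _ => ν
  -- A measurable hull of equal measure, so that sections and Fubini are available.
  set D' := toMeasurable (Measure.pi fun _ : ι ⊕ ι => ν) (ghostDeviation ι F γ)
  have hD' : MeasurableSet D' := measurableSet_toMeasurable _ _
  have hmp := measurePreserving_sumPiEquivProdPi_symm (X := fun _ : ι ⊕ ι => X) (fun _ => ν)
  set E := (MeasurableEquiv.sumPiEquivProdPi fun _ : ι ⊕ ι => X).symm ⁻¹' D'
  have hEm : MeasurableSet E := hmp.measurable hD'
  have hE : (μ.prod μ) E ≤ ENNReal.ofReal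
      ((2 * Real.exp 1 * n) ^ d / (d : ℝ) ^ d * (2 * Real.exp (-(n * γ ^ 2 / 2)))) := by
    refine (hmp.measure_preimage hD'.nullMeasurableSet).trans_le ?_
    rw [measure_toMeasurable]
    exact measure_ghostDeviation_le hm hF hd hγ.le
  -- Let `A` witness a deviation of 2γ at `x`. Every `y` whose `A`-frequency is within γ of the
  -- truth then differs from `x` by at least γ, and such `y` have mass at least 1/2.
  have hsub : {x : ι → X | ∃ A ∈ F, n * (2 * γ) ≤
      |∑ i, A.indicator (1 : X → ℝ) (x i) - n * ν.real A|} ⊆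
      {x | 2⁻¹ ≤ μ (Prod.mk x ⁻¹' E)} := by
    rintro x ⟨A, hA, hx⟩
    have h1 : {y : ι → X | n * γ ≤ |∑ i, A.indicator (1 : X → ℝ) (y i) - n * ν.real A|}ᶜ ⊆
        Prod.mk x ⁻¹' E := by
      intro y hy
      refine subset_toMeasurable _ _ ⟨A, hA, ?_⟩
      simp only [Set.mem_compl_iff, Set.mem_ofPred_eq, not_le] at hy
      change n * γ ≤ |∑ i, (A.indicator (1 : X → ℝ) (x i) - A.indicator (1 : X → ℝ) (y i))|
      rw [Finset.sum_sub_distrib]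
      have := abs_sub_abs_le_abs_sub (∑ i, A.indicator (1 : X → ℝ) (x i) - n * ν.real A)
        (∑ i, A.indicator (1 : X → ℝ) (y i) - n * ν.real A)
      rw [sub_sub_sub_cancel_right] at this
      linarith
    have h2 : (1 : ℝ≥0∞) ≤ 2⁻¹ + μ (Prod.mk x ⁻¹' E) := by
      rw [← measure_univ (μ := μ)]
      refine (measure_mono ?_).trans ((measure_union_le _ _).trans
        (add_le_add (measure_frequency_deviation_le ν (hFm A hA) hγ hn)
          (measure_mono h1)))
      rw [Set.union_compl_self]
    have h3 : (2⁻¹ : ℝ≥0∞) + 2⁻¹ ≤ 2⁻¹ + μ (Prod.mk x ⁻¹' E) := by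
      rwa [ENNReal.inv_two_add_inv_two]
    exact (ENNReal.add_le_add_iff_left (by simp)).1 h3
  -- Markov's inequality at level 1/2 for the section measure; this doubling turns Hoeffding's
  -- two-sided factor 2 into 4.
  refine (measure_mono hsub).trans ((meas_ge_le_lintegral_div
    (measurable_measure_prodMk_left hEm).aemeasurable (by simp) (by simp)).trans ?_)
  rw [← Measure.prod_apply hEm, ENNReal.div_eq_inv_mul, inv_inv]
  refine (mul_le_mul_right hE 2).trans_eq ?_
  rw [← ENNReal.ofReal_ofNat 2, ← ENNReal.ofReal_mul (by norm_num)]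
  congr 1
  ring

/-! ### Gaps, maximizers and sample size -/

theorem gap_le {L : ℕ} (q : Fin (L + 1) → Fin (L + 1) → ℝ) {ϑ m : Fin (L + 1)} (h : m ≠ ϑ) :
    gap q ≤ q ϑ ϑ - q ϑ m :=
  (ciInf_le (Set.finite_range _).bddBelow ϑ).trans
    (ciInf_le (f := fun m : {m : Fin (L + 1) // m ≠ ϑ} => q ϑ ϑ - q ϑ m)
      (Set.finite_range _).bddBelow ⟨m, h⟩)

theorem exists_gap_eq {L : ℕ} (hL : 1 ≤ L) (q : Fin (L + 1) → Fin (L + 1) → ℝ) :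
    ∃ ϑ m : Fin (L + 1), m ≠ ϑ ∧ gap q = q ϑ ϑ - q ϑ m := by
  have : Nontrivial (Fin (L + 1)) := Fin.nontrivial_iff_two_le.2 (by omega)
  obtain ⟨ϑ, hϑ⟩ := exists_eq_ciInf_of_finite
    (f := fun ϑ : Fin (L + 1) => ⨅ m : {m : Fin (L + 1) // m ≠ ϑ}, (q ϑ ϑ - q ϑ m))
  have : Nonempty {m : Fin (L + 1) // m ≠ ϑ} := nonempty_subtype.2 (exists_ne ϑ)
  obtain ⟨m, hm⟩ := exists_eq_ciInf_of_finite
    (f := fun m : {m : Fin (L + 1) // m ≠ ϑ} => q ϑ ϑ - q ϑ m)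
  exact ⟨ϑ, m, m.2, (hm.trans hϑ).symm⟩

theorem IsSeparableClassifier.gap_pos {X : Type*} [MeasurableSpace X] {L : ℕ} (hL : 1 ≤ L)
    {P : Fin (L + 1) → ProbabilityMeasure X} {g : X → Fin (L + 1)}
    (hg : IsSeparableClassifier P g) : 0 < gap (conf P g) := by
  obtain ⟨ϑ, m, hm, h⟩ := exists_gap_eq hL (conf P g)
  rw [h]
  exact sub_pos.2 (hg ϑ m hm)

/-- The empirical gap depends only on the labels given to the finitely many sample points, so it
takes finitely many values. -/
theorem empGapArgmax_nonempty {X : Type*} {L N : ℕ} {G : Set (X → Fin (L + 1))}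
    (hG : G.Nonempty) (t : Fin (L + 1) → Fin N → X) : (empGapArgmax G t).Nonempty := by
  let lab : (X → Fin (L + 1)) → Fin (L + 1) → Fin N → Fin (L + 1) := fun g ϑ i => g (t ϑ i)
  obtain ⟨_, ⟨g, hg, rfl⟩, hmax⟩ := Set.exists_max_image (lab '' G)
    (fun y => gap fun ϑ m => (1 / (N : ℝ)) * ∑ i : Fin N, if y ϑ i = m then (1 : ℝ) else 0)
    (Set.toFinite _) (hG.image lab)
  exact ⟨g, hg, fun h hh => hmax _ (Set.mem_image_of_mem lab hh)⟩

/-- If every empirical confusion probability is within `2 γ` of the true one, where `8 γ` is the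
largest gap achieved, then every empirical maximizer is separable. -/
theorem isSeparableClassifier_of_mem_empGapArgmax {X : Type*} [MeasurableSpace X] {L N : ℕ}
    (hL : 1 ≤ L) {G : Set (X → Fin (L + 1))} {P : Fin (L + 1) → ProbabilityMeasure X}
    {t : Fin (L + 1) → Fin N → X} {γ : ℝ}
    (hdev : ∀ g ∈ G, ∀ ϑ m, |empConf t g ϑ m - conf P g ϑ m| < 2 * γ)
    {gstar : X → Fin (L + 1)} (hstar : gstar ∈ G) (hγ : 8 * γ ≤ gap (conf P gstar))
    {g : X → Fin (L + 1)} (hg : g ∈ empGapArgmax G t) : IsSeparableClassifier P g := by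
  intro ϑ m hm
  obtain ⟨ϑ', m', hm', hgap⟩ := exists_gap_eq hL (empConf t gstar)
  have h1 := gap_le (conf P gstar) hm'
  have h2 := gap_le (empConf t g) hm
  have h3 := hg.2 gstar hstar
  have h4 := abs_lt.1 (hdev gstar hstar ϑ' ϑ')
  have h5 := abs_lt.1 (hdev gstar hstar ϑ' m')
  have h6 := abs_lt.1 (hdev g hg.1 ϑ ϑ)
  have h7 := abs_lt.1 (hdev g hg.1 ϑ m)
  linarith [h4.1, h5.2, h6.2, h7.1]

/-- The sample-size condition makes the uniform deviation bound effective at confidence `δ`. -/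
theorem sampleSize_bounds {L d N : ℕ} {γ δ : ℝ} (hγ : 0 < γ) (hδ : 0 < δ) (hδ1 : δ < 1)
    (hN : max (d : ℝ) (8 / γ ^ 2 *
      Real.log (((L : ℝ) + 1) ^ 2 * 4 * ((2 * Real.exp 1 * N) ^ d / (d : ℝ) ^ d) / δ)) ≤ N) :
    1 ≤ N * γ ^ 2 ∧ ((L : ℝ) + 1) ^ 2 * (4 * ((2 * Real.exp 1 * N) ^ d / (d : ℝ) ^ d) *
      Real.exp (-(N * γ ^ 2 / 2))) ≤ δ := by
  have hdN : (d : ℝ) ≤ N := (le_max_left _ _).trans hN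
  have hlog := (le_max_right _ _).trans hN
  have hdd : (0 : ℝ) < (d : ℝ) ^ d := by
    rcases Nat.eq_zero_or_pos d with rfl | h
    · simp
    · positivity
  set W := (2 * Real.exp 1 * N) ^ d / (d : ℝ) ^ d
  have hW : 1 ≤ W := by
    refine (one_le_div hdd).2 (pow_le_pow_left₀ (Nat.cast_nonneg d) ?_ d)
    have : (1 : ℝ) ≤ Real.exp 1 := Real.one_le_exp (by norm_num)
    have hN0 : (0 : ℝ) ≤ N := Nat.cast_nonneg N
    nlinarith
  have hL2 : (1 : ℝ) ≤ ((L : ℝ) + 1) ^ 2 := one_le_pow₀ (by linarith [Nat.cast_nonneg (α := ℝ) L])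
  set M := ((L : ℝ) + 1) ^ 2 * 4 * W
  have hM : 4 ≤ M := by
    have : (1 : ℝ) ≤ ((L : ℝ) + 1) ^ 2 * W := one_le_mul_of_one_le_of_one_le hL2 hW
    simp only [M]
    linarith
  -- As 4 > e, the logarithm is at least 1, so the single condition on `N` also yields the Chebyshev
  -- requirement 1 ≤ Nγ².
  have hMδ : 4 ≤ M / δ := (le_div_iff₀ hδ).2 (by nlinarith)
  have hlog1 : 1 ≤ Real.log (M / δ) := by
    rw [Real.le_log_iff_exp_le (by linarith)]
    linarith [Real.exp_one_lt_d9]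
  have hlog2 : 8 * Real.log (M / δ) ≤ N * γ ^ 2 := by
    rwa [div_mul_eq_mul_div, div_le_iff₀ (by positivity)] at hlog
  refine ⟨by linarith, ?_⟩
  have h1 : M / δ ≤ Real.exp (N * γ ^ 2 / 2) :=
    (Real.log_le_iff_le_exp (by linarith)).1 (by linarith)
  rw [div_le_iff₀ hδ] at h1
  calc ((L : ℝ) + 1) ^ 2 * (4 * W * Real.exp (-(N * γ ^ 2 / 2)))
      = M * Real.exp (-(N * γ ^ 2 / 2)) := by simp only [M]; ring
    _ ≤ Real.exp (N * γ ^ 2 / 2) * δ * Real.exp (-(N * γ ^ 2 / 2)) := by gcongr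
    _ = δ := by rw [mul_right_comm, ← Real.exp_add]; simp

theorem abs_empConf_sub_conf_lt {X : Type*} [MeasurableSpace X] {L N : ℕ} (hN : 0 < N)
    {P : Fin (L + 1) → ProbabilityMeasure X} {t : Fin (L + 1) → Fin N → X} {g : X → Fin (L + 1)}
    {ϑ m : Fin (L + 1)} {r : ℝ}
    (h : |∑ i, {x | g x = m}.indicator (1 : X → ℝ) (t ϑ i) -
      N * (P ϑ : Measure X).real {x | g x = m}| < N * r) :
    |empConf t g ϑ m - conf P g ϑ m| < r := by
  have hN' : (0 : ℝ) < N := by exact_mod_cast hN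
  have h1 : ∑ i, {x | g x = m}.indicator (1 : X → ℝ) (t ϑ i) -
      N * (P ϑ : Measure X).real {x | g x = m} = N * (empConf t g ϑ m - conf P g ϑ m) := by
    simp only [empConf, conf, Set.indicator_apply, Set.mem_ofPred_eq, Pi.one_apply]
    field_simp
  rw [h1, abs_mul, abs_of_pos hN'] at h
  exact lt_of_mul_lt_mul_left h hN'.le

end EmpSep

/-! ### Union bound over label pairs -/

theorem mainTheorem4 {X : Type*} [MeasurableSpace X] (L : ℕ) (hL : 1 ≤ L)
    -- the hypothesis class of measurable classifiers
    (G : Set (X → Fin (L + 1))) (hG : ∀ g ∈ G, Measurable g)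
    (P : Fin (L + 1) → ProbabilityMeasure X) (hP : P ∈ EmpSep.Psep G)
    (hmeas : ∀ ϑ m : Fin (L + 1),
      EmpSep.SampleMeasurable (EmpSep.labelClass G m) (P ϑ : Measure X))
    (d : ℕ) (hd : ∀ m : Fin (L + 1), EmpSep.vcDim (EmpSep.labelClass G m) ≤ (d : ℕ∞)) :
    (∃ gstar ∈ G, 0 < EmpSep.gap (EmpSep.conf P gstar)) ∧
    ∀ gstar ∈ G, 0 < EmpSep.gap (EmpSep.conf P gstar) →
      ∀ γ : ℝ, γ = EmpSep.gap (EmpSep.conf P gstar) / 8 →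
      ∀ δ : ℝ, 0 < δ → δ < 1 →
      ∀ N : ℕ,
        max (d : ℝ) (8 / γ ^ 2 *
          Real.log (((L : ℝ) + 1) ^ 2 * 4 * ((2 * Real.exp 1 * N) ^ d / (d : ℝ) ^ d) / δ)) ≤ N →
      -- the training data: for each label `ϑ`, an i.i.d. sample of size `N` from `P ϑ`
      ∀ {Ω : Type*} [MeasurableSpace Ω] (μ : Measure Ω) [IsProbabilityMeasure μ]
        (T : Fin (L + 1) → Fin N → Ω → X),
        (∀ ϑ i, HasLaw (T ϑ i) (P ϑ : Measure X) μ) →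
        (∀ ϑ, iIndepFun (T ϑ) μ) →
        -- empirical-gap maximizers exist, and with probability at least `1 - δ` all are separable
        (∀ ω, (EmpSep.empGapArgmax G fun ϑ i => T ϑ i ω).Nonempty) ∧
        ∃ E : Set Ω, MeasurableSet E ∧ 1 - δ ≤ μ.real E ∧
          ∀ ω ∈ E, ∀ ghat ∈ EmpSep.empGapArgmax G (fun ϑ i => T ϑ i ω),
            EmpSep.IsSeparableClassifier P ghat := by
  obtain ⟨g₀, hg₀, hsep⟩ := hP
  refine ⟨⟨g₀, hg₀, hsep.gap_pos hL⟩, ?_⟩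
  intro gstar hstar hpos γ hγ δ hδ hδ1 N hN Ω _ μ _ T hlaw hind
  refine ⟨fun ω => EmpSep.empGapArgmax_nonempty ⟨g₀, hg₀⟩ _, ?_⟩
  have hγ0 : 0 < γ := by rw [hγ]; positivity
  obtain ⟨hNγ, hbound⟩ := EmpSep.sampleSize_bounds hγ0 hδ hδ1 hN
  have hdN : d ≤ N := by exact_mod_cast (le_max_left _ _).trans hN
  have hN0 : 0 < N := by
    rcases Nat.eq_zero_or_pos N with rfl | h
    · norm_num at hNγ
    · exact h
  set r : ℝ := 4 * ((2 * Real.exp 1 * N) ^ d / (d : ℝ) ^ d) * Real.exp (-(N * γ ^ 2 / 2))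
  let bad : Fin (L + 1) → Fin (L + 1) → Set (Fin N → X) := fun ϑ m =>
    {x | ∃ A ∈ EmpSep.labelClass G m, N * (2 * γ) ≤
      |∑ i, A.indicator (1 : X → ℝ) (x i) - N * (P ϑ : Measure X).real A|}
  let B : Set Ω := ⋃ ϑ, ⋃ m, (fun ω i => T ϑ i ω) ⁻¹' bad ϑ m
  have hbad : ∀ ϑ m, μ ((fun ω i => T ϑ i ω) ⁻¹' bad ϑ m) ≤ ENNReal.ofReal r := by
    intro ϑ m
    have hT : ∀ i, AEMeasurable (T ϑ i) μ := fun i => (hlaw ϑ i).aemeasurable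
    have hmap : μ.map (fun ω i => T ϑ i ω) = Measure.pi fun _ => (P ϑ : Measure X) := by
      rw [(iIndepFun_iff_map_fun_eq_pi_map hT).1 (hind ϑ)]
      simp_rw [(hlaw ϑ _).map_eq]
    -- This inequality holds for arbitrary sets; `bad ϑ m` is not known to be measurable.
    refine (Measure.le_map_apply (aemeasurable_pi_lambda _ hT) _).trans ?_
    rw [hmap]
    have hmeasA : ∀ A ∈ EmpSep.labelClass G m, MeasurableSet A := by
      rintro _ ⟨g, hg, rfl⟩
      exact hG g hg (MeasurableSet.singleton m)
    have h := EmpSep.measure_uniform_deviation_le (ι := Fin N) (hmeas ϑ m) hmeasA (hd m)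
      (by simpa using hdN) hγ0 (by simpa using hNγ)
    simpa only [Fintype.card_fin] using h
  have hB : μ B ≤ ENNReal.ofReal δ := by
    calc μ B ≤ ∑ ϑ, ∑ m, μ ((fun ω i => T ϑ i ω) ⁻¹' bad ϑ m) :=
          (measure_iUnion_fintype_le _ _).trans
            (Finset.sum_le_sum fun ϑ _ => measure_iUnion_fintype_le _ _)
      _ ≤ ∑ _ϑ : Fin (L + 1), ∑ _m : Fin (L + 1), ENNReal.ofReal r :=
          Finset.sum_le_sum fun ϑ _ => Finset.sum_le_sum fun m _ => hbad ϑ m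
      _ = ENNReal.ofReal (((L : ℝ) + 1) ^ 2 * r) := by
          have hcast : ((L : ℝ) + 1) ^ 2 = (((L + 1) * (L + 1) : ℕ) : ℝ) := by push_cast; ring
          rw [hcast, ENNReal.ofReal_mul (Nat.cast_nonneg _), ENNReal.ofReal_natCast]
          simp [mul_assoc]
      _ ≤ ENNReal.ofReal δ := ENNReal.ofReal_le_ofReal hbound
  -- The hull of `B` has the same measure, and its complement is a genuine event avoiding `B`.
  refine ⟨(toMeasurable μ B)ᶜ, (measurableSet_toMeasurable _ _).compl, ?_, ?_⟩
  · rw [probReal_compl_eq_one_sub (measurableSet_toMeasurable _ _)]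
    refine sub_le_sub_left ?_ 1
    rw [Measure.real, measure_toMeasurable]
    exact ENNReal.toReal_le_of_le_ofReal hδ.le hB
  · intro ω hω ghat hghat
    refine EmpSep.isSeparableClassifier_of_mem_empGapArgmax (γ := γ) hL (fun g hg ϑ m => ?_) hstar
      (by rw [hγ]; linarith) hghat
    refine EmpSep.abs_empConf_sub_conf_lt hN0 (lt_of_not_ge fun h => hω ?_)
    exact subset_toMeasurable _ _ (Set.mem_iUnion₂.2 ⟨ϑ, m, _, ⟨g, hg, rfl⟩, h⟩)
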